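/- Theorem 6.3. Let $n$ be a natural number and let $G$ be a (finite) group given as a subgroup of the symmetric group $S_n$. Represent $S_n$ in the unitary group $\mathbf U(n)$ by coordinate permutations, $(\sigma z)_i = z_{\sigma^{-1}(i)}$, and regard $G\subseteq S_n\subseteq \mathbf U(n)\subseteq \mathrm{Aut}(\mathbb B^n)$, where $\mathbb B^n$ is the open unit ball of $\mathbb C^n$ and $\mathrm{Aut}(\mathbb B^n)$ is its group of holomorphic automorphisms. For a map $f:\mathbb B^n\to\mathbb B^N$, let $\Gamma_f$ (the Hermitian invariant group of $f$) be the subgroup of all $\gamma\in\mathrm{Aut}(\mathbb B^n)$ for which there is a $\psi\in\mathrm{Aut}(\mathbb B^N)$ with $f\circ\gamma=\psi\circ f$. Then there are an integer $N$ and a proper polynomial map $f:\mathbb B^n\to\mathbb B^N$ such that $\Gamma_f=G$ as subgroups of $\mathrm{Aut}(\mathbb B^n)$. -/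

import Mathlib

/-- Complex Euclidean space `ℂⁿ` with its Hermitian norm. -/
abbrev Cn (n : ℕ) : Type := EuclideanSpace ℂ (Fin n)

/-- The open unit ball `𝔹ⁿ` of `ℂⁿ`. -/
abbrev UnitBall (n : ℕ) : Type := Metric.ball (0 : Cn n) 1

/-- A map between unit balls is holomorphic: it is the restriction to the ball of a map that is
complex (Fréchet) differentiable at every point of the (open) ball. -/
def IsHolomorphic {n m : ℕ} (f : UnitBall n → UnitBall m) : Prop :=
  ∃ F : Cn n → Cn m, DifferentiableOn ℂ F (Metric.ball 0 1) ∧ ∀ z : UnitBall n, F z = f z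

theorem IsHolomorphic.id (n : ℕ) : IsHolomorphic (fun z : UnitBall n => z) :=
  ⟨fun z => z, differentiableOn_id, fun _ => rfl⟩

theorem IsHolomorphic.comp {n m k : ℕ} {g : UnitBall m → UnitBall k} {f : UnitBall n → UnitBall m}
    (hg : IsHolomorphic g) (hf : IsHolomorphic f) : IsHolomorphic (fun z => g (f z)) := by
  obtain ⟨G, hG, hGg⟩ := hg
  obtain ⟨F, hF, hFf⟩ := hf
  refine ⟨fun z => G (F z), hG.comp hF ?_, fun z => ?_⟩
  · intro z hz
    have h := hFf ⟨z, hz⟩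
    simp only at h
    rw [h]
    exact (f ⟨z, hz⟩).2
  · change G (F z) = g (f z)
    rw [hFf z, hGg (f z)]

/-- The holomorphic automorphism group `Aut(𝔹ⁿ)`: all biholomorphic bijections of the ball,
under composition. -/
def BallAut (n : ℕ) : Subgroup (Equiv.Perm (UnitBall n)) where
  carrier := {γ | IsHolomorphic (fun z => γ z) ∧ IsHolomorphic (fun z => γ⁻¹ z)}
  mul_mem' := fun {a b} ha hb => by
    refine ⟨ha.1.comp hb.1, ?_⟩
    rw [mul_inv_rev]
    exact hb.2.comp ha.2
  one_mem' := by
    refine ⟨IsHolomorphic.id n, ?_⟩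
    rw [inv_one]
    exact IsHolomorphic.id n
  inv_mem' := fun {a} ha => by
    refine ⟨ha.2, ?_⟩
    rw [inv_inv]
    exact ha.1

/-- `f` is Hermitian `Γ`-invariant: for each `γ ∈ Γ` there is an automorphism `ψ` of the target
ball with `f ∘ γ = ψ ∘ f`. -/
def IsHermitianInvariant {n N : ℕ} (f : UnitBall n → UnitBall N) (Γ : Subgroup (BallAut n)) :
    Prop :=
  ∀ γ ∈ Γ, ∃ ψ : BallAut N, ∀ z, f (γ.1 z) = ψ.1 (f z)

/-- The Hermitian invariant group `Γ_f ≤ Aut(𝔹ⁿ)`: all source automorphisms `γ` such that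
`f ∘ γ = ψ ∘ f` for some target automorphism `ψ`. -/
def hermitianInvariantGroup {n N : ℕ} (f : UnitBall n → UnitBall N) : Subgroup (BallAut n) where
  carrier := {γ | ∃ ψ : BallAut N, ∀ z, f (γ.1 z) = ψ.1 (f z)}
  mul_mem' := fun {a b} ⟨ψ, hψ⟩ ⟨χ, hχ⟩ => ⟨ψ * χ, fun z => by
    change f (a.1 (b.1 z)) = ψ.1 (χ.1 (f z))
    rw [hψ, hχ]⟩
  one_mem' := ⟨1, fun _ => rfl⟩
  inv_mem' := fun {a} ⟨ψ, hψ⟩ => ⟨ψ⁻¹, fun z => by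
    change f (a.1⁻¹ z) = ψ.1⁻¹ (f z)
    rw [Equiv.Perm.eq_inv_iff_eq, ← hψ]
    exact congrArg f (a.1.apply_symm_apply z)⟩

/-- `Γ_f` is the maximal subgroup of `Aut(𝔹ⁿ)` for which `f` is Hermitian invariant. -/
theorem hermitianInvariantGroup_isGreatest {n N : ℕ} (f : UnitBall n → UnitBall N) :
    IsGreatest {Γ | IsHermitianInvariant f Γ} (hermitianInvariantGroup f) :=
  ⟨fun _ hγ => hγ, fun _ hΓ γ hγ => hΓ γ hγ⟩

/-- The map between balls is polynomial: each of its components is given by a polynomial in the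
coordinates `z₁, …, zₙ`. -/
def IsPolynomialMap {n N : ℕ} (f : UnitBall n → UnitBall N) : Prop :=
  ∃ p : Fin N → MvPolynomial (Fin n) ℂ,
    ∀ (z : UnitBall n) (i : Fin N), (f z : Cn N) i = MvPolynomial.eval (fun j => (z : Cn n) j) (p i)

/-- The unitary group `U(n)`, as the group of linear isometric bijections of `ℂⁿ`. -/
abbrev UnitaryGp (n : ℕ) : Type := Cn n ≃ₗᵢ[ℂ] Cn n

theorem unitary_mem_ball {n : ℕ} (U : UnitaryGp n) (z : UnitBall n) :
    U (z : Cn n) ∈ Metric.ball (0 : Cn n) 1 := by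
  have h := z.2
  rw [mem_ball_zero_iff] at h ⊢
  rwa [U.norm_map]

/-- The inclusion of `U(n)` in `Aut(𝔹ⁿ)`: a unitary map is restricted to the ball. -/
noncomputable def unitaryToAut (n : ℕ) : UnitaryGp n →* BallAut n where
  toFun U :=
    ⟨{ toFun := fun z => ⟨U z, unitary_mem_ball U z⟩
       invFun := fun z => ⟨U⁻¹ (z : Cn n), unitary_mem_ball U⁻¹ z⟩
       left_inv := fun z => Subtype.ext (U.symm_apply_apply z)
       right_inv := fun z => Subtype.ext (U.apply_symm_apply z) },
      ⟨fun z => U z, U.differentiable.differentiableOn, fun _ => rfl⟩,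
      ⟨fun z => U⁻¹ z, (U⁻¹).differentiable.differentiableOn, fun _ => rfl⟩⟩
  map_one' := rfl
  map_mul' _ _ := rfl

/-- The representation of the symmetric group `Sₙ` in `U(n)` by permutations of the coordinates:
`σ` maps the standard basis vector `e_j` to `e_{σ(j)}`, i.e. `(σ z)_i = z_{σ⁻¹(i)}`. -/
noncomputable def permToUnitary (n : ℕ) : Equiv.Perm (Fin n) →* UnitaryGp n where
  toFun σ := LinearIsometryEquiv.piLpCongrLeft 2 ℂ ℂ σ
  map_one' := LinearIsometryEquiv.ext fun _ => rfl
  map_mul' _ _ := LinearIsometryEquiv.ext fun _ => rfl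

/-! The group `G` is encoded in the Gram kernel ⟨F(z), F(w)⟩ of a polynomial map F. With s = ⟨z, w⟩,
the tensor powers of z of degrees 2, 3, 4 and d = ∑ (j + 5) have total kernel s² + s³ + s⁴ + s^d.
Tensoring with z only along the line that carries p = ∑ z_j³ + ∑ z_j⁴ + ∏ z_j^(j+5) subtracts a
multiple of (1 - s) p(z) conj p(w), which vanishes when z = w is on the sphere. The direct sum of
the translates by `G`, with squared norms divided by 4|G|, is a proper map of balls whose components
are permuted by `G` (`inner_symmetricMap`).

Conversely, the components c z_j² make 0 the only zero of dF, so a source automorphism γ with F ∘ γ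
= ψ ∘ F fixes 0 (`fixes_center_of_mem_hermitianInvariantGroup`). Then ψ fixes 0 too, and Cartan's
theorem makes both unitary. Thus γ = U preserves s and the kernel of F, hence also K(z, w) = ∑_g
p(g⁻¹z) conj p(g⁻¹w). The parts of K of degree 3 in conj w are, up to constants, q(z) conj(∑ w_j³),
where q is the cubic power sum, the quartic power sum, or the sum over `G` of the translates of ∏
z_j^(j+5) (`power_sums_of_markedKernel_eq`). Cubes force U e_k = c e_j, fourth powers force c = 1,
so U permutes coordinates; the last q has stabilizer exactly `G` (`mem_of_staircaseSum_comp`). -/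

/-! ### Schwarz rigidity and Cartan's uniqueness theorem -/

/-- A differentiable map on the unit ball which preserves norms agrees there with its derivative at
the origin. -/
theorem eq_fderiv_zero_of_norm_eq {E F : Type*} [NormedAddCommGroup E] [NormedSpace ℂ E]
    [NormedAddCommGroup F] [NormedSpace ℂ F] [StrictConvexSpace ℝ F] {f : E → F}
    (hd : DifferentiableOn ℂ f (Metric.ball 0 1))
    (hn : ∀ z ∈ Metric.ball (0 : E) 1, ‖f z‖ = ‖z‖) {z : E} (hz : z ∈ Metric.ball (0 : E) 1) :
    f z = fderiv ℂ f 0 z := by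
  have h0 : f 0 = 0 := by
    simpa using hn 0 (Metric.mem_ball_self one_pos)
  rcases eq_or_ne z 0 with rfl | hz0
  · simp [h0]
  have hzpos : 0 < ‖z‖ := norm_pos_iff.2 hz0
  have hz1 : ‖z‖ < 1 := by simpa using hz
  set g : ℂ → F := fun c => f (c • z) with hg
  have hmaps :
      Set.MapsTo (fun c : ℂ => c • z) (Metric.ball 0 (1 / ‖z‖)) (Metric.ball (0 : E) 1) := by
    intro c hc
    have h := (lt_div_iff₀ hzpos).1 (mem_ball_zero_iff.1 hc)
    rwa [mem_ball_zero_iff, norm_smul]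
  have hgd : DifferentiableOn ℂ g (Metric.ball 0 (1 / ‖z‖)) :=
    hd.comp (by fun_prop) hmaps
  have hg0 : g 0 = 0 := by simp [hg, h0]
  have hslope : dslope g 0 1 = f z := by
    rw [dslope_of_ne _ one_ne_zero, slope_def_module, hg0]
    simp [hg]
  have hgm : Set.MapsTo g (Metric.ball 0 (1 / ‖z‖)) (Metric.closedBall (g 0) 1) := by
    intro c hc
    have h := hmaps hc
    have h2 := hn _ h
    rw [hg0, mem_closedBall_zero_iff]
    exact h2.le.trans (mem_ball_zero_iff.1 h).le
  -- Equality case of the Schwarz lemma on the disc of radius 1/‖z‖: the slope from 0 to 1 has the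
  -- extremal norm ‖z‖, so g is linear.
  have haff := Complex.affine_of_mapsTo_ball_of_norm_dslope_eq_div hgd hgm (z₀ := 1)
    (by simpa using one_lt_inv_iff₀.2 ⟨hzpos, hz1⟩) (by rw [hslope, hn z hz]; simp)
  have hball : Metric.ball (0 : ℂ) (1 / ‖z‖) ∈ nhds (0 : ℂ) :=
    Metric.ball_mem_nhds _ (by positivity)
  have hd1 : HasDerivAt g (f z) 0 := by
    have h1 : HasDerivAt (fun c : ℂ => c • f z) ((1 : ℂ) • f z) 0 :=
      (hasDerivAt_id (0 : ℂ)).smul_const (f z)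
    rw [one_smul] at h1
    refine h1.congr_of_eventuallyEq ?_
    filter_upwards [hball] with c hc
    rw [haff hc, hslope, hg0]
    simp
  have hd2 : HasDerivAt g (fderiv ℂ f 0 z) 0 := by
    have hf : HasFDerivAt f (fderiv ℂ f 0) ((0 : ℂ) • z) := by
      rw [zero_smul]
      exact (hd.differentiableAt (Metric.ball_mem_nhds _ one_pos)).hasFDerivAt
    have h1 : HasDerivAt (fun c : ℂ => c • z) ((1 : ℂ) • z) 0 :=
      (hasDerivAt_id (0 : ℂ)).smul_const z
    rw [one_smul] at h1
    exact hf.comp_hasDerivAt (0 : ℂ) h1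
  exact hd1.unique hd2

theorem zero_mem_unitBall (n : ℕ) : (0 : Cn n) ∈ Metric.ball (0 : Cn n) 1 :=
  Metric.mem_ball_self one_pos

/-- The centre of the unit ball. -/
def ballCenter (n : ℕ) : UnitBall n := ⟨0, zero_mem_unitBall n⟩

/-- The Schwarz lemma for holomorphic maps between balls fixing the origin. -/
theorem IsHolomorphic.norm_le {n m : ℕ} {f : UnitBall n → UnitBall m} (hf : IsHolomorphic f)
    (h0 : f (ballCenter n) = ballCenter m) (z : UnitBall n) :
    ‖(f z : Cn m)‖ ≤ ‖(z : Cn n)‖ := by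
  obtain ⟨F, hF, hFf⟩ := hf
  rw [← hFf z]
  refine Complex.norm_le_norm_of_mapsTo_ball hF (fun w hw => ?_) ?_ (mem_ball_zero_iff.1 z.2)
  · rw [hFf ⟨w, hw⟩]
    exact Metric.ball_subset_closedBall (f ⟨w, hw⟩).2
  · rw [show (0 : Cn n) = ballCenter n from rfl, hFf, h0]
    rfl

/-- The Schwarz lemma applies to γ and to its inverse. -/
theorem norm_apply_of_fixes_center {n : ℕ} (γ : BallAut n)
    (h0 : γ.1 (ballCenter n) = ballCenter n) (z : UnitBall n) :
    ‖(γ.1 z : Cn n)‖ = ‖(z : Cn n)‖ := by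
  refine le_antisymm (IsHolomorphic.norm_le γ.2.1 h0 z) ?_
  have h := IsHolomorphic.norm_le γ.2.2
    (by rw [Equiv.Perm.inv_eq_iff_eq, h0]) (γ.1 z)
  simpa using h

/-- All small positive multiples of a vector lie in the unit ball. -/
theorem exists_smul_mem_unitBall {n : ℕ} (z : Cn n) :
    ∃ t : ℝ, 0 < t ∧ ∀ s : ℝ, 0 < s → s ≤ t → ((s : ℂ) • z) ∈ Metric.ball (0 : Cn n) 1 := by
  refine ⟨(‖z‖ + 1)⁻¹, by positivity, fun s hs hst => ?_⟩
  have hp : 0 < ‖z‖ + 1 := by positivity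
  rw [mem_ball_zero_iff, norm_smul, Complex.norm_real, Real.norm_of_nonneg hs.le]
  calc s * ‖z‖ ≤ (‖z‖ + 1)⁻¹ * ‖z‖ := by gcongr
    _ < 1 := by rw [inv_mul_lt_iff₀ hp]; linarith

/-- **Cartan's uniqueness theorem** for the ball: an automorphism fixing the origin is unitary. -/
theorem exists_unitary_of_fixes_center {n : ℕ} (γ : BallAut n)
    (h0 : γ.1 (ballCenter n) = ballCenter n) : ∃ U : UnitaryGp n, γ = unitaryToAut n U := by
  obtain ⟨F, hF, hFγ⟩ := γ.2.1
  have hFn : ∀ z ∈ Metric.ball (0 : Cn n) 1, ‖F z‖ = ‖z‖ := fun z hz => by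
    rw [hFγ ⟨z, hz⟩]
    exact norm_apply_of_fixes_center γ h0 ⟨z, hz⟩
  have hlin : ∀ z ∈ Metric.ball (0 : Cn n) 1, F z = fderiv ℂ F 0 z :=
    fun z hz => eq_fderiv_zero_of_norm_eq hF hFn hz
  have hnorm : ∀ z, ‖fderiv ℂ F 0 z‖ = ‖z‖ := by
    intro z
    obtain ⟨t, ht, hb⟩ := exists_smul_mem_unitBall z
    have hm := hb t ht le_rfl
    have h := hFn _ hm
    rw [hlin _ hm, map_smul, norm_smul, norm_smul] at h
    exact mul_left_cancel₀ (by simpa using ht.ne') h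
  let A : Cn n →ₗᵢ[ℂ] Cn n := ⟨(fderiv ℂ F 0).toLinearMap, hnorm⟩
  refine ⟨A.toLinearIsometryEquiv rfl, Subtype.ext (Equiv.ext fun z => Subtype.ext ?_)⟩
  change (γ.1 z : Cn n) = fderiv ℂ F 0 z
  rw [← hlin _ z.2, hFγ z]

/-! ### Polynomial maps of balls -/

/-- The polynomial map between complex Euclidean spaces with a given finite family of components. -/
noncomputable def polyMap {n : ℕ} {ι : Type} [Fintype ι] (P : ι → MvPolynomial (Fin n) ℂ)
    (z : Cn n) : Cn (Fintype.card ι) :=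
  WithLp.toLp 2 fun i => MvPolynomial.eval (fun j => z j) (P ((Fintype.equivFin ι).symm i))

section polyMap

variable {n : ℕ} {ι : Type} [Fintype ι] (P : ι → MvPolynomial (Fin n) ℂ)

theorem polyMap_apply (z : Cn n) (i : Fin (Fintype.card ι)) :
    polyMap P z i = MvPolynomial.eval (fun j => z j) (P ((Fintype.equivFin ι).symm i)) := rfl

theorem inner_polyMap (z w : Cn n) :
    inner ℂ (polyMap P w) (polyMap P z) = ∑ i, MvPolynomial.eval (fun j => z j) (P i) *
      (starRingEnd ℂ) (MvPolynomial.eval (fun j => w j) (P i)) := by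
  rw [PiLp.inner_apply, ← (Fintype.equivFin ι).symm.sum_comp]
  rfl

theorem differentiable_eval (q : MvPolynomial (Fin n) ℂ) :
    Differentiable ℂ fun z : Cn n => MvPolynomial.eval (fun j => z j) q := by
  induction q using MvPolynomial.induction_on with
  | C a => simp
  | add p q hp hq =>
    simp only [map_add]
    exact hp.add hq
  | mul_X p i hp =>
    simp only [map_mul, MvPolynomial.eval_X]
    exact hp.mul (by fun_prop)

theorem differentiable_polyMap : Differentiable ℂ (polyMap P) :=
  (differentiable_euclidean (𝕜 := ℂ)).2 fun _ => differentiable_eval _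

end polyMap

/-- The restriction to the open balls of a map between Euclidean spaces. -/
def ballRestrict {n N : ℕ} (F : Cn n → Cn N)
    (hF : ∀ z ∈ Metric.ball (0 : Cn n) 1, F z ∈ Metric.ball (0 : Cn N) 1) :
    UnitBall n → UnitBall N :=
  fun z => ⟨F z, hF z z.2⟩

/-- A continuous map taking the open ball to the open ball and the sphere to the sphere restricts
to a proper map of the open balls. -/
theorem isProperMap_ballRestrict {n N : ℕ} {F : Cn n → Cn N} (hc : Continuous F)
    (hF : ∀ z ∈ Metric.ball (0 : Cn n) 1, F z ∈ Metric.ball (0 : Cn N) 1)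
    (hS : ∀ z, ‖z‖ = 1 → ‖F z‖ = 1) : IsProperMap (ballRestrict F hF) := by
  rw [isProperMap_iff_isCompact_preimage]
  refine ⟨(hc.comp continuous_subtype_val).subtype_mk _, fun K hK => ?_⟩
  rw [Subtype.isCompact_iff] at hK ⊢
  -- Intersecting with the closed ball gives compactness and adds no point: the sphere goes to the
  -- sphere, which misses K.
  have hcl : IsCompact (Metric.closedBall (0 : Cn n) 1 ∩ F ⁻¹' (Subtype.val '' K)) :=
    (isCompact_closedBall _ _).inter_right (hK.isClosed.preimage hc)
  convert hcl using 1
  ext z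
  constructor
  · rintro ⟨w, hw, rfl⟩
    exact ⟨Metric.ball_subset_closedBall w.2, _, hw, rfl⟩
  · rintro ⟨hz, k, hk, hkz⟩
    have hk1 : ‖(k : Cn N)‖ < 1 := mem_ball_zero_iff.1 k.2
    have hz1 : z ∈ Metric.ball (0 : Cn n) 1 := by
      rw [mem_ball_zero_iff]
      refine lt_of_le_of_ne (mem_closedBall_zero_iff.1 hz) fun h => ?_
      rw [hkz, hS z h] at hk1
      exact lt_irrefl _ hk1
    refine ⟨⟨z, hz1⟩, ?_, rfl⟩
    have : ballRestrict F hF ⟨z, hz1⟩ = k := Subtype.ext hkz.symm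
    rwa [Set.mem_preimage, this]

theorem isPolynomialMap_ballRestrict_polyMap {n : ℕ} {ι : Type} [Fintype ι]
    (P : ι → MvPolynomial (Fin n) ℂ)
    (hF : ∀ z ∈ Metric.ball (0 : Cn n) 1, polyMap P z ∈ Metric.ball (0 : Cn _) 1) :
    IsPolynomialMap (ballRestrict (polyMap P) hF) :=
  ⟨fun i => P ((Fintype.equivFin ι).symm i), fun _ _ => rfl⟩

/-- A unitary map which permutes the components of `polyMap P` lies in its Hermitian invariant
group. -/
theorem unitaryToAut_mem_hermitianInvariantGroup {n : ℕ} {ι : Type} [Fintype ι]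
    (P : ι → MvPolynomial (Fin n) ℂ)
    (hF : ∀ z ∈ Metric.ball (0 : Cn n) 1, polyMap P z ∈ Metric.ball (0 : Cn _) 1)
    (U : UnitaryGp n) (π : Equiv.Perm ι)
    (h : ∀ z : Cn n, ∀ i, MvPolynomial.eval (fun j => U z j) (P i) =
      MvPolynomial.eval (fun j => z j) (P (π i))) :
    unitaryToAut n U ∈ hermitianInvariantGroup (ballRestrict (polyMap P) hF) := by
  let e := Fintype.equivFin ι
  -- The inverse appears because `permToUnitary` sends z to the vector with coordinates z_{σ⁻¹(i)}.
  refine ⟨unitaryToAut _ (permToUnitary _ ((e.symm.trans π).trans e)⁻¹),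
    fun z => Subtype.ext (PiLp.ext fun i => ?_)⟩
  change polyMap P (U z) i = polyMap P z (((e.symm.trans π).trans e) i)
  rw [polyMap_apply, polyMap_apply, h]
  simp [e]

/-! ### Zeros of the derivative and reduction to unitary maps -/

/-- Chain rule on both sides of F ∘ γ = ψ ∘ F: the right side has derivative zero wherever F does.
-/
theorem fderiv_comp_of_eqOn {n N : ℕ} {F : Cn n → Cn N} (hFd : Differentiable ℂ F)
    (hF : ∀ z ∈ Metric.ball (0 : Cn n) 1, F z ∈ Metric.ball (0 : Cn N) 1)
    {γ : UnitBall n → UnitBall n} {ψ : UnitBall N → UnitBall N} {A : Cn n → Cn n}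
    (hA : DifferentiableOn ℂ A (Metric.ball 0 1)) (hAγ : ∀ z : UnitBall n, A z = γ z)
    (hψ : IsHolomorphic ψ) (h : ∀ z, ballRestrict F hF (γ z) = ψ (ballRestrict F hF z))
    (z : UnitBall n) (hz : fderiv ℂ F z = 0) :
    (fderiv ℂ F (γ z)).comp (fderiv ℂ A z) = 0 := by
  obtain ⟨B, hB, hBψ⟩ := hψ
  have hball : Metric.ball (0 : Cn n) 1 ∈ nhds (z : Cn n) := Metric.isOpen_ball.mem_nhds z.2
  have hl : HasFDerivAt (fun x => F (A x)) ((fderiv ℂ F (γ z)).comp (fderiv ℂ A z)) (z : Cn n) := by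
    have h1 : HasFDerivAt F (fderiv ℂ F (γ z)) (A z) := by
      rw [hAγ]
      exact (hFd _).hasFDerivAt
    exact h1.comp (z : Cn n) (hA.differentiableAt hball).hasFDerivAt
  have hr : HasFDerivAt (fun x => B (F x)) ((fderiv ℂ B (F z)).comp (fderiv ℂ F z)) (z : Cn n) :=
    (hB.differentiableAt (Metric.isOpen_ball.mem_nhds (hF z z.2))).hasFDerivAt.comp (z : Cn n)
      (hFd _).hasFDerivAt
  have heq : (fun x => F (A x)) =ᶠ[nhds (z : Cn n)] fun x => B (F x) := by
    filter_upwards [hball] with x hx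
    have h1 := congrArg Subtype.val (h ⟨x, hx⟩)
    rw [← hBψ] at h1
    have h2 := hAγ ⟨x, hx⟩
    simp only at h2
    rw [h2]
    exact h1
  rw [(hl.congr_of_eventuallyEq heq.symm).unique hr, hz, ContinuousLinearMap.comp_zero]

/-- If `0` is the only critical point of rank zero of `F`, then the source automorphisms in the
Hermitian invariant group of `F` fix the origin. -/
theorem fixes_center_of_mem_hermitianInvariantGroup {n N : ℕ} {F : Cn n → Cn N}
    (hFd : Differentiable ℂ F)
    (hF : ∀ z ∈ Metric.ball (0 : Cn n) 1, F z ∈ Metric.ball (0 : Cn N) 1)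
    (h0 : fderiv ℂ F 0 = 0) (hne : ∀ z, fderiv ℂ F z = 0 → z = 0) {γ : BallAut n} {ψ : BallAut N}
    (h : ∀ z, ballRestrict F hF (γ.1 z) = ψ.1 (ballRestrict F hF z)) :
    γ.1 (ballCenter n) = ballCenter n := by
  obtain ⟨A, hA, hAγ⟩ := γ.2.1
  obtain ⟨A', hA', hAγ'⟩ := γ.2.2
  have hcomp := fderiv_comp_of_eqOn hFd hF hA hAγ ψ.2.1 h (ballCenter n) h0
  set b := γ.1 (ballCenter n) with hb
  have hball : Metric.ball (0 : Cn n) 1 ∈ nhds (b : Cn n) := Metric.isOpen_ball.mem_nhds b.2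
  -- The derivative of γ at 0 has a right inverse, so it can be cancelled from `hcomp`.
  have hinv : (fderiv ℂ A (ballCenter n)).comp (fderiv ℂ A' b) =
      ContinuousLinearMap.id ℂ (Cn n) := by
    have hAb : A' b = ballCenter n := by
      rw [hAγ', hb]
      simp
    have h1 : HasFDerivAt A (fderiv ℂ A (ballCenter n)) (A' b) := by
      rw [hAb]
      exact (hA.differentiableAt (Metric.isOpen_ball.mem_nhds (ballCenter n).2)).hasFDerivAt
    have h2 := h1.comp (b : Cn n) (hA'.differentiableAt hball).hasFDerivAt
    refine h2.unique ((hasFDerivAt_id (b : Cn n)).congr_of_eventuallyEq ?_)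
    filter_upwards [hball] with x hx
    have h3 := hAγ' ⟨x, hx⟩
    simp only at h3
    rw [Function.comp_apply, h3, hAγ]
    simp
  have hz : fderiv ℂ F b = 0 := by
    calc fderiv ℂ F b = (fderiv ℂ F b).comp
          ((fderiv ℂ A (ballCenter n)).comp (fderiv ℂ A' b)) := by
            rw [hinv, ContinuousLinearMap.comp_id]
      _ = 0 := by
        rw [← ContinuousLinearMap.comp_assoc, hcomp, ContinuousLinearMap.zero_comp]
  exact Subtype.ext (hne _ hz)

/-- If `F` vanishes to second order at the origin and has no other critical point of rank zero, then
its Hermitian invariant group consists of unitary maps, and they preserve the Gram kernel of `F`. -/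
theorem exists_unitary_of_mem_hermitianInvariantGroup {n N : ℕ} {F : Cn n → Cn N}
    (hFd : Differentiable ℂ F)
    (hF : ∀ z ∈ Metric.ball (0 : Cn n) 1, F z ∈ Metric.ball (0 : Cn N) 1)
    (hle : ∀ z ∈ Metric.ball (0 : Cn n) 1, ‖F z‖ ≤ ‖z‖ ^ 2)
    (hne : ∀ z, fderiv ℂ F z = 0 → z = 0) {γ : BallAut n}
    (hγ : γ ∈ hermitianInvariantGroup (ballRestrict F hF)) :
    ∃ U : UnitaryGp n, γ = unitaryToAut n U ∧ ∀ z ∈ Metric.ball (0 : Cn n) 1,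
      ∀ w ∈ Metric.ball (0 : Cn n) 1, inner ℂ (F (U w)) (F (U z)) = inner ℂ (F w) (F z) := by
  obtain ⟨ψ, h⟩ := hγ
  have h00 : F 0 = 0 := by
    simpa using hle 0 (zero_mem_unitBall n)
  have h0 : fderiv ℂ F 0 = 0 := by
    refine (Asymptotics.IsBigO.hasFDerivAt (n := 2) ?_ one_lt_two).fderiv
    refine Asymptotics.IsBigO.of_bound 1 ?_
    filter_upwards [Metric.ball_mem_nhds (0 : Cn n) one_pos] with z hz
    simpa using hle z hz
  have hγ0 := fixes_center_of_mem_hermitianInvariantGroup hFd hF h0 hne h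
  have hfc : ballRestrict F hF (ballCenter n) = ballCenter N := Subtype.ext h00
  have hψ0 : ψ.1 (ballCenter N) = ballCenter N := by
    have := h (ballCenter n)
    rw [hγ0, hfc] at this
    exact this.symm
  obtain ⟨U, rfl⟩ := exists_unitary_of_fixes_center γ hγ0
  obtain ⟨V, rfl⟩ := exists_unitary_of_fixes_center ψ hψ0
  have hV : ∀ z ∈ Metric.ball (0 : Cn n) 1, F (U z) = V (F z) := fun z hz =>
    congrArg Subtype.val (h ⟨z, hz⟩)
  refine ⟨U, rfl, fun z hz w hw => ?_⟩
  rw [hV z hz, hV w hw, V.inner_map_map]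

/-! ### Tensor powers, partial tensor products and translates -/

open MvPolynomial in
/-- The monomial spelled by a word in the variables. -/
noncomputable def wordMonomial {n : ℕ} {W : Type} [Fintype W] (a : W → Fin n) :
    MvPolynomial (Fin n) ℂ :=
  ∏ t, X (a t)

/-- Expanding the power gives one term per word; indexing by words rather than by monomials avoids
multinomial weights. -/
theorem sum_eval_wordMonomial {n : ℕ} (W : Type) [Fintype W] [DecidableEq W] (x y : Fin n → ℂ) :
    ∑ a : W → Fin n, MvPolynomial.eval x (wordMonomial a) *
      (starRingEnd ℂ) (MvPolynomial.eval y (wordMonomial a)) =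
      (∑ j, x j * (starRingEnd ℂ) (y j)) ^ Fintype.card W := by
  simp only [wordMonomial, map_prod, MvPolynomial.eval_X, ← Finset.prod_mul_distrib]
  rw [← Finset.card_univ, ← Finset.prod_const, Finset.prod_univ_sum, Fintype.piFinset_univ]

section partialTensor

variable {n : ℕ} {I : Type} [Fintype I] (v : I → MvPolynomial (Fin n) ℂ) (u : I → ℝ)

/-- The linear combination of a family of polynomials with given real coefficients. -/
noncomputable def combination : MvPolynomial (Fin n) ℂ :=
  ∑ i, MvPolynomial.C (u i : ℂ) * v i

/-- The family obtained from `v` by tensoring its orthogonal projection on the line spanned by `u`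
with the identity map. -/
noncomputable def partialTensor : I ⊕ Fin n → MvPolynomial (Fin n) ℂ :=
  Sum.elim (fun i => v i - MvPolynomial.C ((u i / ∑ k, u k ^ 2 : ℝ) : ℂ) * combination v u)
    (fun j => MvPolynomial.C (((√(∑ k, u k ^ 2))⁻¹ : ℝ) : ℂ) * MvPolynomial.X j * combination v u)

/-- The line spanned by u contributes p(x) conj p(y) / ∑ u_k² to the kernel, orthogonally to the
rest; tensoring multiplies this share by ∑ x_j conj y_j. -/
theorem sum_eval_partialTensor (hm : 0 < ∑ k, u k ^ 2) (x y : Fin n → ℂ) :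
    ∑ i, MvPolynomial.eval x (partialTensor v u i) *
      (starRingEnd ℂ) (MvPolynomial.eval y (partialTensor v u i)) =
    ∑ i, MvPolynomial.eval x (v i) * (starRingEnd ℂ) (MvPolynomial.eval y (v i)) -
      (1 - ∑ j, x j * (starRingEnd ℂ) (y j)) * ((∑ k, u k ^ 2 : ℝ) : ℂ)⁻¹ *
        (MvPolynomial.eval x (combination v u) *
          (starRingEnd ℂ) (MvPolynomial.eval y (combination v u))) := by
  have hp : ∀ x, MvPolynomial.eval x (combination v u) =
      ∑ i, (u i : ℂ) * MvPolynomial.eval x (v i) :=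
    fun x => by simp [combination]
  have hq : (starRingEnd ℂ) (MvPolynomial.eval y (combination v u)) =
      ∑ i, (u i : ℂ) * (starRingEnd ℂ) (MvPolynomial.eval y (v i)) := by
    rw [hp]
    simp
  set m : ℝ := ∑ k, u k ^ 2 with hmdef
  set p := MvPolynomial.eval x (combination v u)
  set q := (starRingEnd ℂ) (MvPolynomial.eval y (combination v u))
  have hpx := hp x
  have hmC : (m : ℂ) ≠ 0 := by exact_mod_cast hm.ne'
  have hmu : (m : ℂ) = ∑ i, (u i : ℂ) * u i := by
    rw [hmdef]
    push_cast
    exact Finset.sum_congr rfl fun i _ => by ring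
  have hs : (((√m)⁻¹ : ℝ) : ℂ) * (((√m)⁻¹ : ℝ) : ℂ) = (m : ℂ)⁻¹ := by
    rw [← Complex.ofReal_mul, ← mul_inv, Real.mul_self_sqrt hm.le, Complex.ofReal_inv]
  rw [Fintype.sum_sum_type]
  have h1 : ∀ i, MvPolynomial.eval x (partialTensor v u (Sum.inl i)) *
      (starRingEnd ℂ) (MvPolynomial.eval y (partialTensor v u (Sum.inl i))) =
      MvPolynomial.eval x (v i) * (starRingEnd ℂ) (MvPolynomial.eval y (v i))
      - (q * (m : ℂ)⁻¹) * (u i * MvPolynomial.eval x (v i))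
      - (p * (m : ℂ)⁻¹) * (u i * (starRingEnd ℂ) (MvPolynomial.eval y (v i)))
      + (p * q * (m : ℂ)⁻¹ * (m : ℂ)⁻¹) * ((u i : ℂ) * u i) := by
    intro i
    simp only [partialTensor, Sum.elim_inl, map_sub, map_mul, MvPolynomial.eval_C,
      Complex.conj_ofReal]
    change (_ - ((u i / m : ℝ) : ℂ) * p) * (_ - ((u i / m : ℝ) : ℂ) * q) = _
    push_cast
    ring
  have h2 : ∀ j, MvPolynomial.eval x (partialTensor v u (Sum.inr j)) *
      (starRingEnd ℂ) (MvPolynomial.eval y (partialTensor v u (Sum.inr j))) =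
      ((m : ℂ)⁻¹ * p * q) * (x j * (starRingEnd ℂ) (y j)) := by
    intro j
    simp only [partialTensor, Sum.elim_inr, map_mul, MvPolynomial.eval_C, Complex.conj_ofReal,
      MvPolynomial.eval_X]
    change (((√m)⁻¹ : ℝ) : ℂ) * x j * p * ((((√m)⁻¹ : ℝ) : ℂ) * _ * q) = _
    rw [← hs]
    ring
  simp only [h1, h2, Finset.sum_add_distrib, Finset.sum_sub_distrib, ← Finset.mul_sum]
  rw [← hpx, ← hq, ← hmu]
  field_simp
  ring

end partialTensor

section symmetrization

variable {n : ℕ} (G : Subgroup (Equiv.Perm (Fin n))) {J : Type}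
  (c : ℝ) (h : J → MvPolynomial (Fin n) ℂ)

/-- The direct sum of the translates of a polynomial family by a group of permutations. -/
noncomputable def symmetrization : G × J → MvPolynomial (Fin n) ℂ :=
  fun k => MvPolynomial.C (c : ℂ) * MvPolynomial.rename (k.1.1⁻¹ : Equiv.Perm (Fin n)) (h k.2)

theorem eval_symmetrization (x : Fin n → ℂ) (k : G × J) :
    MvPolynomial.eval x (symmetrization G c h k) =
      c * MvPolynomial.eval (fun j => x (k.1.1⁻¹ j)) (h k.2) := by
  simp [symmetrization, MvPolynomial.eval_rename, Function.comp_def]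

theorem sum_eval_symmetrization [Fintype G] [Fintype J] (x y : Fin n → ℂ) :
    ∑ k, MvPolynomial.eval x (symmetrization G c h k) *
      (starRingEnd ℂ) (MvPolynomial.eval y (symmetrization G c h k)) =
    (c : ℂ) ^ 2 * ∑ g : G, ∑ j, MvPolynomial.eval (fun i => x (g.1⁻¹ i)) (h j) *
      (starRingEnd ℂ) (MvPolynomial.eval (fun i => y (g.1⁻¹ i)) (h j)) := by
  rw [Fintype.sum_prod_type, Finset.mul_sum]
  refine Finset.sum_congr rfl fun g _ => ?_
  rw [Finset.mul_sum]
  refine Finset.sum_congr rfl fun j _ => ?_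
  rw [eval_symmetrization, eval_symmetrization, map_mul, Complex.conj_ofReal]
  ring

end symmetrization

/-! ### The marked polynomial -/

/-- The index type of the positions in the monomial `∏ z_j ^ (j + 5)`. -/
abbrev StaircaseIndex (n : ℕ) : Type := Σ j : Fin n, Fin (j + 5)

/-- The words of lengths `2`, `3`, `4` and `∑ (j + 5)`. -/
abbrev WordIndex (n : ℕ) : Type :=
  (Fin 2 → Fin n) ⊕ (Fin 3 → Fin n) ⊕ (Fin 4 → Fin n) ⊕ (StaircaseIndex n → Fin n)

/-- The monomials spelled by the words in `WordIndex n`. -/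
noncomputable def wordFamily (n : ℕ) : WordIndex n → MvPolynomial (Fin n) ℂ :=
  Sum.elim wordMonomial (Sum.elim wordMonomial (Sum.elim wordMonomial wordMonomial))

/-- The indicator of the words `jjj`, `jjjj` and of one word for `∏ z_j ^ (j + 5)`. -/
noncomputable def markedWords (n : ℕ) : WordIndex n → ℝ :=
  Sum.elim 0 (Sum.elim (fun a => ∑ j, if a = fun _ => j then 1 else 0)
    (Sum.elim (fun a => ∑ j, if a = fun _ => j then 1 else 0)
      (fun a => if a = Sigma.fst then 1 else 0)))

/-- The polynomial `∑ z_j ^ 3 + ∑ z_j ^ 4 + ∏ z_j ^ (j + 5)`. -/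
noncomputable def markedPoly (n : ℕ) : MvPolynomial (Fin n) ℂ :=
  combination (wordFamily n) (markedWords n)

theorem eval_markedPoly (n : ℕ) (x : Fin n → ℂ) :
    MvPolynomial.eval x (markedPoly n) =
      ∑ j, x j ^ 3 + ∑ j, x j ^ 4 + ∏ j : Fin n, x j ^ ((j : ℕ) + 5) := by
  have key : ∀ (W : Type) [Fintype W] [DecidableEq W] (b : (W → Fin n) → ℂ),
      ∑ a : W → Fin n, (∑ j, if a = fun _ => j then (1 : ℂ) else 0) * b a =
        ∑ j, b fun _ => j := by
    intro W _ _ b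
    simp only [Finset.sum_mul]
    rw [Finset.sum_comm]
    simp
  simp only [markedPoly, combination, wordFamily, markedWords, Fintype.sum_sum_type, Sum.elim_inl,
    Sum.elim_inr, map_add, map_sum, map_mul, MvPolynomial.eval_C, Pi.zero_apply, Complex.ofReal_sum,
    apply_ite (Complex.ofReal), Complex.ofReal_one, Complex.ofReal_zero, key]
  simp [wordMonomial, Fintype.prod_sigma, add_assoc]

theorem markedWords_pos (n : ℕ) : 0 < ∑ k, markedWords n k ^ 2 := by
  refine Finset.sum_pos' (fun _ _ => sq_nonneg _)
    ⟨Sum.inr (Sum.inr (Sum.inr Sigma.fst)), Finset.mem_univ _, ?_⟩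
  simp [markedWords]

theorem sum_eval_wordFamily (n : ℕ) (x y : Fin n → ℂ) :
    ∑ i, MvPolynomial.eval x (wordFamily n i) *
      (starRingEnd ℂ) (MvPolynomial.eval y (wordFamily n i)) =
    (∑ j, x j * (starRingEnd ℂ) (y j)) ^ 2 + (∑ j, x j * (starRingEnd ℂ) (y j)) ^ 3 +
      (∑ j, x j * (starRingEnd ℂ) (y j)) ^ 4 +
      (∑ j, x j * (starRingEnd ℂ) (y j)) ^ Fintype.card (StaircaseIndex n) := by
  simp only [wordFamily, Fintype.sum_sum_type, Sum.elim_inl, Sum.elim_inr]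
  simp only [sum_eval_wordMonomial, Fintype.card_fin, add_assoc]

/-- Keeps the degree d apart from the degrees 3 and 4 of the power sums. -/
theorem five_le_card_staircaseIndex {n : ℕ} (hn : 0 < n) :
    5 ≤ Fintype.card (StaircaseIndex n) := by
  have h : Fintype.card (Fin 5) ≤ Fintype.card (StaircaseIndex n) :=
    Fintype.card_le_of_injective (fun t : Fin 5 => (⟨⟨0, hn⟩, ⟨t, by simp⟩⟩ : StaircaseIndex n))
      (fun s t h => by simpa [Fin.ext_iff] using h)
  simpa using h

/-! ### The symmetric map and its Gram kernel -/

section symmetricMap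

variable {n : ℕ} (G : Subgroup (Equiv.Perm (Fin n))) [Fintype G]

/-- The components of a proper polynomial map with Hermitian invariant group `G`. -/
noncomputable def symmetricFamily : G × (WordIndex n ⊕ Fin n) → MvPolynomial (Fin n) ℂ :=
  symmetrization G (√(4 * Fintype.card G))⁻¹ (partialTensor (wordFamily n) (markedWords n))

/-- The polarized sum of the squared moduli of the translates of `markedPoly n`. -/
noncomputable def markedKernel (x y : Fin n → ℂ) : ℂ :=
  ∑ g : G, MvPolynomial.eval (fun i => x (g.1⁻¹ i)) (markedPoly n) *
    (starRingEnd ℂ) (MvPolynomial.eval (fun i => y (g.1⁻¹ i)) (markedPoly n))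

theorem sum_coe_inv_mul (g : Equiv.Perm (Fin n)) (z w : Cn n) :
    ∑ i, z (g⁻¹ i) * (starRingEnd ℂ) (w (g⁻¹ i)) = inner ℂ w z := by
  rw [PiLp.inner_apply]
  exact Equiv.sum_comp g⁻¹ fun i => z i * (starRingEnd ℂ) (w i)

theorem inner_symmetricMap (z w : Cn n) :
    inner ℂ (polyMap (symmetricFamily G) w) (polyMap (symmetricFamily G) z) =
      4⁻¹ * (inner ℂ w z ^ 2 + inner ℂ w z ^ 3 + inner ℂ w z ^ 4 +
        inner ℂ w z ^ Fintype.card (StaircaseIndex n)) -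
      (1 - inner ℂ w z) *
        (((4 * Fintype.card G * ∑ k, markedWords n k ^ 2)⁻¹ : ℝ) : ℂ) * markedKernel G z w := by
  have hG : (0 : ℝ) < Fintype.card G := by exact_mod_cast Fintype.card_pos
  have hc : ((((√(4 * Fintype.card G))⁻¹ : ℝ) : ℂ)) ^ 2 = ((4 * Fintype.card G : ℝ) : ℂ)⁻¹ := by
    rw [← Complex.ofReal_pow, inv_pow, Real.sq_sqrt (by positivity), Complex.ofReal_inv]
  rw [inner_polyMap, symmetricFamily, sum_eval_symmetrization, hc]
  simp only [sum_eval_partialTensor _ _ (markedWords_pos n), sum_eval_wordFamily, sum_coe_inv_mul,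
    Finset.sum_sub_distrib, ← Finset.mul_sum, Finset.sum_const, Finset.card_univ, nsmul_eq_mul]
  change _ * (_ - _ * markedKernel G z w) = _
  have hGC : (Fintype.card G : ℂ) ≠ 0 := by exact_mod_cast hG.ne'
  have hmC : ((∑ k, markedWords n k ^ 2 : ℝ) : ℂ) ≠ 0 := by
    exact_mod_cast (markedWords_pos n).ne'
  rw [Complex.ofReal_inv, Complex.ofReal_mul, Complex.ofReal_mul, Complex.ofReal_natCast]
  generalize ((∑ k, markedWords n k ^ 2 : ℝ) : ℂ) = m at *
  field_simp
  push_cast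
  field_simp

theorem markedKernel_self (x : Fin n → ℂ) :
    ∃ r : ℝ, 0 ≤ r ∧ markedKernel G x x = r := by
  refine ⟨∑ g : G, ‖MvPolynomial.eval (fun i => x (g.1⁻¹ i)) (markedPoly n)‖ ^ 2, by positivity, ?_⟩
  rw [markedKernel, Complex.ofReal_sum]
  exact Finset.sum_congr rfl fun g _ => by rw [Complex.mul_conj']; simp

/-- The correction term has a favourable sign inside the ball and vanishes on the sphere, which
gives both norm statements below. -/
theorem norm_symmetricMap_sq (z : Cn n) :
    ∃ r : ℝ, 0 ≤ r ∧ ‖polyMap (symmetricFamily G) z‖ ^ 2 =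
      ((‖z‖ ^ 2) ^ 2 + (‖z‖ ^ 2) ^ 3 + (‖z‖ ^ 2) ^ 4 +
        (‖z‖ ^ 2) ^ Fintype.card (StaircaseIndex n)) / 4 - (1 - ‖z‖ ^ 2) * r := by
  obtain ⟨r, hr, hk⟩ := markedKernel_self G (fun j => z j)
  have h := inner_symmetricMap G z z
  refine ⟨(4 * Fintype.card G * ∑ k, markedWords n k ^ 2)⁻¹ * r,
    mul_nonneg (inv_nonneg.2 (mul_nonneg (by positivity) (markedWords_pos n).le)) hr, ?_⟩
  rw [inner_self_eq_norm_sq_to_K, inner_self_eq_norm_sq_to_K] at h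
  change _ = _ - _ * _ * markedKernel G (fun j => z j) (fun j => z j) at h
  rw [hk] at h
  apply Complex.ofReal_injective
  rw [Complex.ofReal_pow]
  refine h.trans ?_
  push_cast [Complex.coe_algebraMap]
  ring

theorem norm_symmetricMap_le (hn : 0 < n) (z : Cn n) (hz : z ∈ Metric.ball (0 : Cn n) 1) :
    ‖polyMap (symmetricFamily G) z‖ ≤ ‖z‖ ^ 2 := by
  obtain ⟨r, hr, h⟩ := norm_symmetricMap_sq G z
  have hz1 : ‖z‖ ^ 2 ≤ 1 := pow_le_one₀ (norm_nonneg _) (mem_ball_zero_iff.1 hz).le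
  have h0 : 0 ≤ ‖z‖ ^ 2 := by positivity
  have hd := five_le_card_staircaseIndex hn
  refine (sq_le_sq₀ (norm_nonneg _) h0).1 ?_
  have h3 := pow_le_pow_of_le_one h0 hz1 (show 2 ≤ 3 by norm_num)
  have h4 := pow_le_pow_of_le_one h0 hz1 (show 2 ≤ 4 by norm_num)
  have h5 := pow_le_pow_of_le_one h0 hz1 (show 2 ≤ Fintype.card (StaircaseIndex n) by omega)
  have := mul_nonneg (sub_nonneg.2 hz1) hr
  linarith

theorem symmetricMap_mem_ball (hn : 0 < n) (z : Cn n) (hz : z ∈ Metric.ball (0 : Cn n) 1) :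
    polyMap (symmetricFamily G) z ∈ Metric.ball (0 : Cn _) 1 := by
  have hz1 := mem_ball_zero_iff.1 hz
  exact mem_ball_zero_iff.2 ((norm_symmetricMap_le G hn z hz).trans_lt
    (pow_lt_one₀ (norm_nonneg _) hz1 two_ne_zero))

theorem norm_symmetricMap_of_norm_eq_one (z : Cn n) (hz : ‖z‖ = 1) :
    ‖polyMap (symmetricFamily G) z‖ = 1 := by
  obtain ⟨r, -, h⟩ := norm_symmetricMap_sq G z
  rw [hz] at h
  refine (pow_eq_one_iff_of_nonneg (norm_nonneg _) two_ne_zero).1 ?_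
  rw [h]
  norm_num

theorem eq_zero_of_fderiv_symmetricMap (z : Cn n)
    (hz : fderiv ℂ (polyMap (symmetricFamily G)) z = 0) : z = 0 := by
  ext j
  set c : ℝ := (√(4 * Fintype.card G))⁻¹ with hc
  have hcpos : 0 < c := by
    have hG : (0 : ℝ) < Fintype.card G := by exact_mod_cast Fintype.card_pos
    positivity
  -- The word jj has weight zero in `markedWords`, so the partial tensor product leaves z_j²
  -- untouched.
  let k : G × (WordIndex n ⊕ Fin n) := (1, Sum.inl (Sum.inl fun _ => j))
  have hk : ∀ w : Cn n, polyMap (symmetricFamily G) w (Fintype.equivFin _ k) = c * w j ^ 2 := by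
    intro w
    rw [polyMap_apply, Equiv.symm_apply_apply, symmetricFamily, eval_symmetrization]
    simp [k, partialTensor, markedWords, wordFamily, wordMonomial, c]
    rfl
  have hF : HasFDerivAt (polyMap (symmetricFamily G)) (0 : Cn n →L[ℂ] _)
      (z + (0 : ℂ) • EuclideanSpace.single j (1 : ℂ)) := by
    rw [zero_smul, add_zero, ← hz]
    exact (differentiable_polyMap _ z).hasFDerivAt
  have hline : HasDerivAt (fun t : ℂ => z + t • EuclideanSpace.single j (1 : ℂ))
      ((1 : ℂ) • EuclideanSpace.single j (1 : ℂ)) 0 :=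
    ((hasDerivAt_id (0 : ℂ)).smul_const _).const_add z
  have h1 := (hasDerivAt_pi.1 ((PiLp.hasFDerivAt_ofLp 2 _).comp_hasDerivAt (0 : ℂ)
    (hF.comp_hasDerivAt (0 : ℂ) hline))) (Fintype.equivFin _ k)
  have h2 : HasDerivAt (fun t : ℂ => (c : ℂ) * (z j + t) ^ 2) (c * (2 * (z j + 0) ^ 1 * 1)) 0 := by
    simpa using (((hasDerivAt_id (0 : ℂ)).const_add (z j)).pow 2).const_mul (c : ℂ)
  have h3 := h1.unique (h2.congr_of_eventuallyEq (Filter.Eventually.of_forall fun t => by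
    simp [hk]))
  simpa [hcpos.ne'] using h3
end symmetricMap

/-! ### Recovering the group from the kernel -/

/-- Monomials of three different degrees are linearly independent on an interval. -/
theorem eq_zero_of_sum_pow_eq_zero {i j k : ℕ} (hij : i ≠ j) (hik : i ≠ k) (hjk : j ≠ k)
    {a b c : ℂ} {ε : ℝ} (hε : 0 < ε)
    (h : ∀ t : ℝ, 0 < t → t ≤ ε → (t : ℂ) ^ i * a + (t : ℂ) ^ j * b + (t : ℂ) ^ k * c = 0) :
    a = 0 ∧ b = 0 ∧ c = 0 := by
  have hp : (Polynomial.monomial i a + Polynomial.monomial j b + Polynomial.monomial k c) = 0 := by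
    refine Polynomial.eq_zero_of_infinite_isRoot _ (Set.Infinite.mono ?_
      ((Set.Ioc_infinite hε).image Complex.ofReal_injective.injOn))
    rintro _ ⟨t, ht, rfl⟩
    have := h t ht.1 ht.2
    simp only [Set.mem_ofPred_eq, Polynomial.IsRoot, Polynomial.eval_add, Polynomial.eval_monomial]
    linear_combination this
  refine ⟨?_, ?_, ?_⟩
  · simpa [Polynomial.coeff_monomial, hij.symm, hik.symm] using
      congrArg (Polynomial.coeff · i) hp
  · simpa [Polynomial.coeff_monomial, hij, hjk.symm] using
      congrArg (Polynomial.coeff · j) hp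
  · simpa [Polynomial.coeff_monomial, hik, hjk] using
      congrArg (Polynomial.coeff · k) hp

/-- A unit vector whose cubic power sum has modulus one has a single nonzero coordinate. -/
theorem exists_single_of_norm_sum_cube_eq_one {n : ℕ} {y : Cn n} (hy : ‖y‖ = 1)
    (h3 : ‖∑ j, y j ^ 3‖ = 1) : ∃ j c, y = EuclideanSpace.single j c := by
  have hsum : ∑ j, ‖y j‖ ^ 2 = 1 := by
    rw [← EuclideanSpace.norm_sq_eq, hy, one_pow]
  have hle1 : ∀ j, ‖y j‖ ≤ 1 := fun j => by
    rw [← hy]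
    exact PiLp.norm_apply_le y j
  have hle : ∀ j ∈ Finset.univ, 0 ≤ ‖y j‖ ^ 2 - ‖y j‖ ^ 3 := fun j _ =>
    sub_nonneg.2 (pow_le_pow_of_le_one (norm_nonneg _) (hle1 j) (by norm_num))
  -- The triangle inequality gives ∑ ‖y_j‖³ ≥ 1 = ∑ ‖y_j‖², while each term here is nonnegative; so
  -- every ‖y_j‖ is 0 or 1.
  have hz : ∑ j, (‖y j‖ ^ 2 - ‖y j‖ ^ 3) = 0 := by
    refine le_antisymm ?_ (Finset.sum_nonneg hle)
    rw [Finset.sum_sub_distrib, hsum, ← h3]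
    have := norm_sum_le Finset.univ fun j => y j ^ 3
    simp only [norm_pow] at this
    linarith
  have h01 : ∀ j, y j ≠ 0 → ‖y j‖ = 1 := fun j hj => by
    have h := (Finset.sum_eq_zero_iff_of_nonneg hle).1 hz j (Finset.mem_univ j)
    have h2 : ‖y j‖ ^ 2 * (1 - ‖y j‖) = 0 := by linear_combination h
    rcases mul_eq_zero.1 h2 with h' | h'
    · simp_all
    · linarith
  obtain ⟨j, hj⟩ : ∃ j, y j ≠ 0 := by
    by_contra! hall
    simp [hall] at hsum
  refine ⟨j, y j, ?_⟩
  ext k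
  rw [PiLp.single_apply]
  split_ifs with hkj
  · rw [hkj]
  · by_contra hk
    have hpair := Finset.sum_le_sum_of_subset_of_nonneg (Finset.subset_univ {j, k})
      (fun i _ _ => sq_nonneg ‖y i‖)
    rw [hsum, Finset.sum_pair (Ne.symm hkj), h01 j hj, h01 k hk] at hpair
    norm_num at hpair

/-- The exponents of the translate of `∏ z_j ^ (j + 5)` by a permutation. -/
noncomputable def staircaseExponent {n : ℕ} (σ : Equiv.Perm (Fin n)) : Fin n →₀ ℕ :=
  Finsupp.equivFunOnFinite.symm fun i => (σ i : ℕ) + 5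

theorem staircaseExponent_injective {n : ℕ} :
    Function.Injective (staircaseExponent (n := n)) := by
  intro σ τ h
  ext i
  have := DFunLike.congr_fun h i
  simpa [staircaseExponent] using this

theorem prod_inv_pow_eq_eval {n : ℕ} (σ : Equiv.Perm (Fin n)) (x : Fin n → ℂ) :
    ∏ j : Fin n, x (σ⁻¹ j) ^ ((j : ℕ) + 5) =
      MvPolynomial.eval x (MvPolynomial.monomial (staircaseExponent σ) 1) := by
  rw [MvPolynomial.eval_monomial, one_mul, Finsupp.prod_fintype _ _ (fun _ => pow_zero _),
    ← Equiv.prod_comp σ]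
  simp [staircaseExponent]

section symmetricMap

variable {n : ℕ} (G : Subgroup (Equiv.Perm (Fin n))) [Fintype G]

/-- The sum over a permutation group of the translates of `∏ z_j ^ (j + 5)`. -/
noncomputable def staircaseSum (x : Fin n → ℂ) : ℂ :=
  ∑ g : G, ∏ j : Fin n, x (g.1⁻¹ j) ^ ((j : ℕ) + 5)

/-- The stabilizer of `staircaseSum G` in the symmetric group is `G`. -/
theorem mem_of_staircaseSum_comp (τ : Equiv.Perm (Fin n))
    (h : ∀ x : Fin n → ℂ, staircaseSum G (fun i => x (τ⁻¹ i)) = staircaseSum G x) : τ ∈ G := by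
  have hp : ∑ g : G, MvPolynomial.monomial (staircaseExponent (g.1 * τ)) (1 : ℂ) =
      ∑ g : G, MvPolynomial.monomial (staircaseExponent g.1) (1 : ℂ) := by
    refine MvPolynomial.funext fun x => ?_
    rw [map_sum, map_sum]
    simp only [← prod_inv_pow_eq_eval, mul_inv_rev]
    exact h x
  -- On the left only g = 1 contributes to this coefficient; on the right only g = τ can, which
  -- needs τ ∈ G.
  have hc := congrArg (MvPolynomial.coeff (staircaseExponent τ)) hp
  simp only [MvPolynomial.coeff_sum, MvPolynomial.coeff_monomial,
    staircaseExponent_injective.eq_iff, mul_eq_right, OneMemClass.coe_eq_one] at hc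
  rw [Finset.sum_ite_eq' Finset.univ (1 : G)] at hc
  by_contra hτ
  have hzero : ∀ g ∈ (Finset.univ : Finset G),
      (if (g : Equiv.Perm (Fin n)) = τ then (1 : ℂ) else 0) = 0 :=
    fun g _ => if_neg fun hg => hτ (by rw [← hg]; exact g.2)
  rw [Finset.sum_eq_zero hzero, if_pos (Finset.mem_univ _)] at hc
  exact one_ne_zero hc

theorem card_staircaseIndex : Fintype.card (StaircaseIndex n) = ∑ j : Fin n, ((j : ℕ) + 5) := by
  simp

theorem eval_markedPoly_smul (t : ℂ) (x : Fin n → ℂ) :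
    MvPolynomial.eval (fun i => t * x i) (markedPoly n) =
      t ^ 3 * ∑ j, x j ^ 3 + t ^ 4 * ∑ j, x j ^ 4 +
        t ^ Fintype.card (StaircaseIndex n) * ∏ j : Fin n, x j ^ ((j : ℕ) + 5) := by
  rw [eval_markedPoly, card_staircaseIndex, ← Finset.prod_pow_eq_pow_sum]
  simp only [mul_pow, Finset.mul_sum, Finset.prod_mul_distrib]

theorem eval_markedPoly_perm_smul (g : Equiv.Perm (Fin n)) (t : ℂ) (x : Fin n → ℂ) :
    MvPolynomial.eval (fun i => t * x (g⁻¹ i)) (markedPoly n) =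
      t ^ 3 * ∑ j, x j ^ 3 + t ^ 4 * ∑ j, x j ^ 4 +
        t ^ Fintype.card (StaircaseIndex n) * ∏ j : Fin n, x (g⁻¹ j) ^ ((j : ℕ) + 5) := by
  rw [eval_markedPoly_smul, Equiv.sum_comp g⁻¹ (fun i => x i ^ 3),
    Equiv.sum_comp g⁻¹ (fun i => x i ^ 4)]

/-- The sum of the translates of `markedPoly n`. -/
noncomputable def markedSum (x : Fin n → ℂ) : ℂ :=
  ∑ g : G, MvPolynomial.eval (fun i => x (g.1⁻¹ i)) (markedPoly n)

theorem markedSum_smul (t : ℂ) (x : Fin n → ℂ) :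
    markedSum G (fun i => t * x i) =
      t ^ 3 * (Fintype.card G * ∑ j, x j ^ 3) + t ^ 4 * (Fintype.card G * ∑ j, x j ^ 4) +
        t ^ Fintype.card (StaircaseIndex n) * staircaseSum G x := by
  simp only [markedSum, eval_markedPoly_perm_smul, Finset.sum_add_distrib, ← Finset.mul_sum,
    Finset.sum_const, Finset.card_univ, nsmul_eq_mul, staircaseSum]

/-- The polarized pairing of the translates of `markedPoly n` and of `∏ z_j ^ (j + 5)`. -/
noncomputable def staircaseKernel (x y : Fin n → ℂ) : ℂ :=
  ∑ g : G, MvPolynomial.eval (fun i => x (g.1⁻¹ i)) (markedPoly n) *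
    (starRingEnd ℂ) (∏ j : Fin n, y (g.1⁻¹ j) ^ ((j : ℕ) + 5))

/-- Power sums are invariant under permutations, so they leave the sum over `G`; only the part of
degree d still depends on g. -/
theorem markedKernel_smul_right (t : ℝ) (x y : Fin n → ℂ) :
    markedKernel G x (fun i => (t : ℂ) * y i) =
      (t : ℂ) ^ 3 * (markedSum G x * (starRingEnd ℂ) (∑ j, y j ^ 3)) +
      (t : ℂ) ^ 4 * (markedSum G x * (starRingEnd ℂ) (∑ j, y j ^ 4)) +
      (t : ℂ) ^ Fintype.card (StaircaseIndex n) *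
        staircaseKernel G x y := by
  simp only [markedKernel, markedSum, staircaseKernel, eval_markedPoly_perm_smul]
  generalize ∑ j, y j ^ 3 = a
  generalize ∑ j, y j ^ 4 = b
  simp only [Finset.sum_mul, Finset.mul_sum, ← Finset.sum_add_distrib]
  refine Finset.sum_congr rfl fun g _ => ?_
  simp only [map_add, map_mul, map_pow, Complex.conj_ofReal]
  ring

/-- A linear map preserving `markedKernel` on the ball preserves its homogeneous parts. -/
theorem power_sums_of_markedKernel_eq (hn : 0 < n) {U : UnitaryGp n}
    (hU : ∀ z ∈ Metric.ball (0 : Cn n) 1, ∀ w ∈ Metric.ball (0 : Cn n) 1,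
      markedKernel G (U z) (U w) = markedKernel G z w) (z w : Cn n) :
    (∑ j, U z j ^ 3) * (starRingEnd ℂ) (∑ j, U w j ^ 3) =
        (∑ j, z j ^ 3) * (starRingEnd ℂ) (∑ j, w j ^ 3) ∧
      (∑ j, U z j ^ 4) * (starRingEnd ℂ) (∑ j, U w j ^ 3) =
        (∑ j, z j ^ 4) * (starRingEnd ℂ) (∑ j, w j ^ 3) ∧
      staircaseSum G (U z) * (starRingEnd ℂ) (∑ j, U w j ^ 3) =
        staircaseSum G z * (starRingEnd ℂ) (∑ j, w j ^ 3) := by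
  have hd := five_le_card_staircaseIndex hn
  obtain ⟨ε, hε, hz⟩ := exists_smul_mem_unitBall z
  obtain ⟨δ, hδ, hw⟩ := exists_smul_mem_unitBall w
  have hsmul : ∀ (t : ℂ) (x : Cn n), ((U (t • x) : Cn n) : Fin n → ℂ) = fun i => t * U x i := by
    intro t x
    rw [map_smul]
    rfl
  have hGC : (Fintype.card G : ℂ) ≠ 0 := by exact_mod_cast Fintype.card_ne_zero
  have h1 : ∀ s : ℝ, 0 < s → s ≤ ε →
      markedSum G (fun i => (s : ℂ) * U z i) * (starRingEnd ℂ) (∑ j, U w j ^ 3) -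
        markedSum G (fun i => (s : ℂ) * z i) * (starRingEnd ℂ) (∑ j, w j ^ 3) = 0 := by
    intro s hs hsε
    -- The coefficient of t³ in the second variable t w, with s z held fixed.
    refine (eq_zero_of_sum_pow_eq_zero (show 3 ≠ 4 by norm_num)
      (show 3 ≠ Fintype.card (StaircaseIndex n) by omega)
      (show 4 ≠ Fintype.card (StaircaseIndex n) by omega) hδ
      (b := markedSum G (fun i => (s : ℂ) * U z i) * (starRingEnd ℂ) (∑ j, U w j ^ 4) -
        markedSum G (fun i => (s : ℂ) * z i) * (starRingEnd ℂ) (∑ j, w j ^ 4))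
      (c := staircaseKernel G (fun i => (s : ℂ) * U z i) (U w) -
        staircaseKernel G (fun i => (s : ℂ) * z i) w) fun t ht htδ => ?_).1
    have h := hU _ (hz s hs hsε) _ (hw t ht htδ)
    rw [hsmul, hsmul] at h
    change _ = markedKernel G (fun i => (s : ℂ) * z i) (fun i => (t : ℂ) * w i) at h
    rw [markedKernel_smul_right, markedKernel_smul_right] at h
    linear_combination (exp := 1) h
  -- All three coefficients in s are needed now: s³, s⁴ and s^d.
  have h2 := eq_zero_of_sum_pow_eq_zero (show 3 ≠ 4 by norm_num)
      (show 3 ≠ Fintype.card (StaircaseIndex n) by omega)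
      (show 4 ≠ Fintype.card (StaircaseIndex n) by omega) hε
      (a := Fintype.card G * ((∑ j, U z j ^ 3) * (starRingEnd ℂ) (∑ j, U w j ^ 3) -
        (∑ j, z j ^ 3) * (starRingEnd ℂ) (∑ j, w j ^ 3)))
      (b := Fintype.card G * ((∑ j, U z j ^ 4) * (starRingEnd ℂ) (∑ j, U w j ^ 3) -
        (∑ j, z j ^ 4) * (starRingEnd ℂ) (∑ j, w j ^ 3)))
      (c := staircaseSum G (U z) * (starRingEnd ℂ) (∑ j, U w j ^ 3) -
        staircaseSum G z * (starRingEnd ℂ) (∑ j, w j ^ 3)) fun s hs hsε => by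
    have h := h1 s hs hsε
    rw [markedSum_smul, markedSum_smul] at h
    linear_combination (exp := 1) h
  exact ⟨sub_eq_zero.1 ((mul_eq_zero.1 h2.1).resolve_left hGC),
    sub_eq_zero.1 ((mul_eq_zero.1 h2.2.1).resolve_left hGC), sub_eq_zero.1 h2.2.2⟩

theorem sum_single_pow {k : ℕ} (hk : k ≠ 0) (j : Fin n) (c : ℂ) :
    ∑ i, (EuclideanSpace.single j c : Cn n) i ^ k = c ^ k := by
  rw [Finset.sum_eq_single j] <;> simp +contextual [hk]

/-- A unitary map preserving `markedKernel G` is a coordinate permutation in `G`. -/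
theorem exists_perm_of_markedKernel_eq (hn : 0 < n) {U : UnitaryGp n}
    (hU : ∀ z ∈ Metric.ball (0 : Cn n) 1, ∀ w ∈ Metric.ball (0 : Cn n) 1,
      markedKernel G (U z) (U w) = markedKernel G z w) :
    ∃ τ ∈ G, U = permToUnitary n τ := by
  have hbasis : ∀ k, ∃ j, U (EuclideanSpace.single k 1) = EuclideanSpace.single j 1 := by
    intro k
    have h := power_sums_of_markedKernel_eq G hn hU (EuclideanSpace.single k 1)
      (EuclideanSpace.single k 1)
    obtain ⟨h3, h4, -⟩ := h
    simp only [sum_single_pow (show 3 ≠ 0 by norm_num), sum_single_pow (show 4 ≠ 0 by norm_num),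
      one_pow, map_one, mul_one] at h3 h4
    have hnorm : ‖∑ j, U (EuclideanSpace.single k 1) j ^ 3‖ = 1 := by
      have h := congrArg norm h3
      rw [norm_mul, RCLike.norm_conj, norm_one] at h
      nlinarith [norm_nonneg (∑ j, U (EuclideanSpace.single k 1) j ^ 3)]
    obtain ⟨j, c, hj⟩ := exists_single_of_norm_sum_cube_eq_one
      (by rw [U.norm_map]; simp) hnorm
    rw [hj, sum_single_pow (by norm_num)] at h3 h4
    rw [sum_single_pow (by norm_num)] at h4
    have hc0 : (starRingEnd ℂ) (c ^ 3) ≠ 0 := right_ne_zero_of_mul_eq_one h3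
    -- Both c³ and c⁴ have product 1 with conj(c³); degree 3 alone would leave c undetermined up to
    -- a phase.
    have hc : c ^ 3 * c = c ^ 3 * 1 := by
      rw [mul_one, ← pow_succ]
      exact mul_right_cancel₀ hc0 (h4.trans h3.symm)
    have hc1 : c = 1 := mul_left_cancel₀ (left_ne_zero_of_mul_eq_one h3) hc
    exact ⟨j, by rw [hj, hc1]⟩
  choose τ hτ using hbasis
  have hinj : Function.Injective τ := by
    intro k l hkl
    have h : U (EuclideanSpace.single k 1) = U (EuclideanSpace.single l 1) := by
      rw [hτ, hτ, hkl]
    have h2 := congrArg (fun v : Cn n => v k) (U.injective h)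
    by_contra hne
    simp [hne] at h2
  let σ : Equiv.Perm (Fin n) := Equiv.ofBijective τ (Finite.injective_iff_bijective.1 hinj)
  have hUσ : U = permToUnitary n σ := by
    refine LinearIsometryEquiv.toLinearEquiv_injective
      ((EuclideanSpace.basisFun (Fin n) ℂ).toBasis.ext' fun k => ?_)
    rw [OrthonormalBasis.coe_toBasis, EuclideanSpace.basisFun_apply]
    refine (hτ k).trans ?_
    exact (LinearIsometryEquiv.piLpCongrLeft_single (p := 2) (𝕜 := ℂ) σ k (1 : ℂ)).symm
  refine ⟨σ, mem_of_staircaseSum_comp G σ fun x => ?_, hUσ⟩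
  -- A basis vector as w makes both cubic factors equal to 1.
  have h := (power_sums_of_markedKernel_eq G hn hU (WithLp.toLp 2 x)
    (EuclideanSpace.single ⟨0, hn⟩ 1)).2.2
  rw [hτ, sum_single_pow (by norm_num), sum_single_pow (by norm_num), one_pow, map_one, mul_one,
    mul_one, hUσ] at h
  exact h

/-- U preserves s = ⟨z, w⟩, and s ≠ 1 inside the ball by Cauchy–Schwarz, so the factor 1 - s
cancels. -/
theorem markedKernel_eq_of_inner_eq {U : UnitaryGp n} {z w : Cn n}
    (hz : z ∈ Metric.ball (0 : Cn n) 1) (hw : w ∈ Metric.ball (0 : Cn n) 1)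
    (h : inner ℂ (polyMap (symmetricFamily G) (U w)) (polyMap (symmetricFamily G) (U z)) =
      inner ℂ (polyMap (symmetricFamily G) w) (polyMap (symmetricFamily G) z)) :
    markedKernel G (U z) (U w) = markedKernel G z w := by
  rw [inner_symmetricMap, inner_symmetricMap, U.inner_map_map] at h
  have h1 : 1 - inner ℂ w z ≠ 0 := by
    intro h0
    have hle := norm_inner_le_norm (𝕜 := ℂ) w z
    rw [← sub_eq_zero.1 h0, norm_one] at hle
    have := mul_lt_one_of_nonneg_of_lt_one_left (norm_nonneg w) (mem_ball_zero_iff.1 hw)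
      (mem_ball_zero_iff.1 hz).le
    linarith
  have h2 : (((4 * Fintype.card G * ∑ k, markedWords n k ^ 2)⁻¹ : ℝ) : ℂ) ≠ 0 := by
    have hG : (0 : ℝ) < Fintype.card G := by exact_mod_cast Fintype.card_pos
    exact_mod_cast inv_ne_zero (mul_pos (by positivity) (markedWords_pos n)).ne'
  exact mul_left_cancel₀ (mul_ne_zero h1 h2) (sub_right_injective h)

/-! ### The Hermitian invariant group -/

theorem hermitianInvariantGroup_symmetricMap (hn : 0 < n) :
    hermitianInvariantGroup (ballRestrict (polyMap (symmetricFamily G))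
      (symmetricMap_mem_ball G hn)) = G.map ((unitaryToAut n).comp (permToUnitary n)) := by
  ext γ
  constructor
  · intro hγ
    obtain ⟨U, rfl, hU⟩ := exists_unitary_of_mem_hermitianInvariantGroup
      (differentiable_polyMap _) (symmetricMap_mem_ball G hn) (norm_symmetricMap_le G hn)
      (eq_zero_of_fderiv_symmetricMap G) hγ
    obtain ⟨τ, hτ, rfl⟩ := exists_perm_of_markedKernel_eq G hn fun z hz w hw =>
      markedKernel_eq_of_inner_eq G hz hw (hU z hz w hw)
    exact ⟨τ, hτ, rfl⟩
  · rintro ⟨σ, hσ, rfl⟩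
    -- The translate by g evaluated at σz is the translate by gσ evaluated at z.
    refine unitaryToAut_mem_hermitianInvariantGroup _ _ _
      ((Equiv.mulRight (⟨σ, hσ⟩ : G)).prodCongr (Equiv.refl _)) fun z k => ?_
    rw [symmetricFamily, eval_symmetrization, eval_symmetrization]
    rfl

end symmetricMap

theorem theorem6p3 (n : ℕ) (G : Subgroup (Equiv.Perm (Fin n))) :
    ∃ (N : ℕ) (f : UnitBall n → UnitBall N),
      IsPolynomialMap f ∧ IsProperMap f ∧
        hermitianInvariantGroup f = G.map ((unitaryToAut n).comp (permToUnitary n)) := by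
  rcases Nat.eq_zero_or_pos n with rfl | hn
  -- The construction needs n > 0, since d = 0 for n = 0; there the ball is a point and the identity
  -- map serves.
  · have : Subsingleton (BallAut 0) := ⟨fun a b => Subtype.ext (Equiv.ext fun z =>
      Subsingleton.elim _ _)⟩
    exact ⟨0, id, ⟨fun i => i.elim0, fun _ i => i.elim0⟩, isProperMap_id, Subsingleton.elim _ _⟩
  · have := Fintype.ofFinite G
    exact ⟨_, _, isPolynomialMap_ballRestrict_polyMap _ (symmetricMap_mem_ball G hn),
      isProperMap_ballRestrict (differentiable_polyMap _).continuous _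
        (norm_symmetricMap_of_norm_eq_one G), hermitianInvariantGroup_symmetricMap G hn⟩
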